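/- A Banach space $E$ (over $\mathbb{R}$ or $\mathbb{C}$) is \emph{reflexive} if the canonical embedding $E\to E^{**}$ is a bijection. A normed space $E$ is \emph{weakly sequentially complete} if for every sequence $(x_n)$ in $E$ such that $(\Lambda x_n)$ converges for every $\Lambda\in E^*$ there is $x\in E$ with $\Lambda x_n\to\Lambda x$ for every $\Lambda\in E^*$. A \emph{uniform algebra} on a compact Hausdorff space $X$ is a closed subalgebra of $C(X)$ (continuous complex-valued functions with the supremum norm) that contains the constant functions and separates the points of $X$. A \emph{nonunital uniform algebra} on a noncompact locally compact Hausdorff space $Y$ is a closed subalgebra $B$ of $C_0(Y)$ (continuous complex-valued functions vanishing at infinity, with the supremum norm) such that for every pair of distinct points $x,y\in Y$ there is $f\in B$ with $f(x)\neq f(y)$ and $f(x)\neq 0$. (1) For every uniform algebra $A$ on a compact Hausdorff space, the following are equivalent: (a) $A$ is weakly sequentially complete; (b) $A$ is reflexive; (c) $A$ is finite-dimensional. (2) For every nonunital uniform algebra $B$ on a noncompact locally compact Hausdorff space, the same three conditions, with $B$ in place of $A$, are equivalent. (3) The failure of weak sequential completeness is inherited by finite-codimensional subspaces: if a Banach space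 $E$ is not weakly sequentially complete and $F\subseteq E$ is a linear subspace (closed or not) of finite codimension, then $F$, with the norm of $E$, is not weakly sequentially complete. -/

import Mathlib

open Filter Topology
open scoped ZeroAtInfty

/-- A normed space is weakly sequentially complete if every weakly Cauchy sequence converges
weakly: whenever `Λ (x n)` converges for each continuous linear functional `Λ`, there is a point
`a` of the space such that `Λ (x n) → Λ a` for each `Λ`. -/
def WeaklySequentiallyComplete (𝕜 : Type*) [RCLike 𝕜] (E : Type*) [NormedAddCommGroup E]
    [NormedSpace 𝕜 E] : Prop :=
  ∀ x : ℕ → E,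
    (∀ Λ : StrongDual 𝕜 E, ∃ c : 𝕜, Tendsto (fun n => Λ (x n)) atTop (𝓝 c)) →
      ∃ a : E, ∀ Λ : StrongDual 𝕜 E, Tendsto (fun n => Λ (x n)) atTop (𝓝 (Λ a))

/-- A normed space is reflexive if the canonical embedding into its (topological) double dual is
a bijection. -/
def ReflexiveSpace (𝕜 : Type*) [RCLike 𝕜] (E : Type*) [NormedAddCommGroup E]
    [NormedSpace 𝕜 E] : Prop :=
  Function.Bijective (NormedSpace.inclusionInDoubleDual 𝕜 E)

/-- A uniform algebra on the compact Hausdorff space `X`: a closed subalgebra of `C(X, ℂ)` that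
contains the constants (as every `Subalgebra` does) and separates the points of `X`. -/
structure IsUniformAlgebra {X : Type*} [TopologicalSpace X] [CompactSpace X] [T2Space X]
    (A : Subalgebra ℂ C(X, ℂ)) : Prop where
  isClosed : IsClosed (A : Set C(X, ℂ))
  separates : ∀ x y : X, x ≠ y → ∃ f ∈ A, f x ≠ f y

/-- A nonunital uniform algebra on the noncompact locally compact Hausdorff space `Y`: a closed
subalgebra of `C₀(Y, ℂ)` that strongly separates the points of `Y`. -/
structure IsNonunitalUniformAlgebra {Y : Type*} [TopologicalSpace Y] [LocallyCompactSpace Y]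
    [T2Space Y] [NoncompactSpace Y] (B : NonUnitalSubalgebra ℂ C₀(Y, ℂ)) : Prop where
  isClosed : IsClosed (B : Set C₀(Y, ℂ))
  stronglySeparates : ∀ x y : Y, x ≠ y → ∃ f ∈ B, f x ≠ f y ∧ f x ≠ 0

/-!
A weakly Cauchy sequence in a reflexive space converges weakly by uniform boundedness, and a
finite-dimensional space is reflexive. The substance lies in the converse, which holds for every
closed subalgebra `B` of `C₀(Y, ℂ)`, with `Y` an arbitrary topological space
(`WeaklySequentiallyComplete.finiteDimensional`). A uniform algebra on a compact space `X` is such a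
subalgebra of `C₀(X, ℂ) = C(X, ℂ)`.

If `∑ ‖u i y‖` is bounded uniformly in `y`, then the partial sums of `u` are weakly Cauchy, so in a
weakly sequentially complete `B` the pointwise sum belongs to `B`
(`WeaklySequentiallyComplete.exists_tendsto_sum`). This criterion, which replaces dominated
convergence for representing measures, is used twice.

* For `f ∈ B` with `‖f‖ ≤ 1` the functions `f / (1 + n (1 - f))` lie in `B`, converge pointwise to
  the indicator function of `{f = 1}`, and have consecutive differences dominated by a telescoping
  series. Hence the indicator function of the set on which a nonzero `f` takes a suitable value of
  maximal modulus is an idempotent of `B` (`exists_mem_indicator`).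
* The sum of an infinite sequence of nonzero orthogonal idempotents of `B` would belong to `B`,
  which the compactness of `{1 / 2 ≤ ‖a‖}` for `a ∈ C₀(Y, ℂ)` forbids
  (`not_exists_orthogonal_idempotents`).

If `B` were infinite-dimensional, the idempotents of the first kind would allow nonzero orthogonal
idempotents to be split off one after another, keeping an infinite-dimensional rest
(`exists_idempotent_mem_corner`), against the second point.

For subspaces of finite codimension, a weakly sequentially complete subspace is norm closed, hence
complemented, with a finite-dimensional complement. Weak sequential completeness passes to the sum.
-/

/-! ### Weak sequential completeness in normed spaces -/

section NormedSpaces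

variable {𝕜 : Type*} [RCLike 𝕜] {E F : Type*} [NormedAddCommGroup E] [NormedSpace 𝕜 E]
  [NormedAddCommGroup F] [NormedSpace 𝕜 F]

theorem WeaklySequentiallyComplete.of_continuousLinearEquiv (e : E ≃L[𝕜] F)
    (h : WeaklySequentiallyComplete 𝕜 E) : WeaklySequentiallyComplete 𝕜 F := by
  intro x hx
  obtain ⟨a, ha⟩ := h (fun n => e.symm (x n)) fun Λ =>
    hx (Λ.comp (e.symm : F →L[𝕜] E))
  refine ⟨e a, fun Λ => ?_⟩
  simpa using ha (Λ.comp (e : E →L[𝕜] F))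

/-- By the uniform boundedness principle the limits of a weakly Cauchy sequence form an element of
the double dual, which reflexivity turns into a point of the space. -/
theorem ReflexiveSpace.weaklySequentiallyComplete (h : ReflexiveSpace 𝕜 E) :
    WeaklySequentiallyComplete 𝕜 E := by
  intro x hx
  choose c hc using hx
  let φ : StrongDual 𝕜 (StrongDual 𝕜 E) :=
    continuousLinearMapOfTendsto (fun n => NormedSpace.inclusionInDoubleDual 𝕜 E (x n))
      (f := c) (tendsto_pi_nhds.2 fun Λ => by simpa using hc Λ)
  obtain ⟨a, ha⟩ := h.2 φ
  refine ⟨a, fun Λ => ?_⟩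
  have : Λ a = c Λ := by
    rw [← NormedSpace.dual_def 𝕜 E a Λ, ha]; rfl
  rw [this]
  exact hc Λ

/-- A functional `φ` on the dual is evaluation at `∑ φ (b* i) • b i`, for any basis `b` with
coordinate functionals `b*`. -/
theorem reflexiveSpace_of_finiteDimensional [FiniteDimensional 𝕜 E] : ReflexiveSpace 𝕜 E := by
  refine ⟨fun x y hxy => (SeparatingDual.eq_iff_forall_dual_eq (R := 𝕜)).2 fun Λ =>
    DFunLike.congr_fun hxy Λ, fun φ => ?_⟩
  let b := Module.finBasis 𝕜 E
  let c (i) : StrongDual 𝕜 E := LinearMap.toContinuousLinearMap (b.coord i)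
  refine ⟨∑ i, φ (c i) • b i, ContinuousLinearMap.ext fun Λ => ?_⟩
  have hΛ : Λ = ∑ i, Λ (b i) • c i := by
    ext x
    conv_lhs => rw [← b.sum_repr x, map_sum]
    rw [sum_apply]
    refine Finset.sum_congr rfl fun i _ => ?_
    rw [map_smul, smul_apply, smul_eq_mul, smul_eq_mul, mul_comm]
    rfl
  rw [NormedSpace.dual_def, map_sum]
  conv_rhs => rw [hΛ, map_sum]
  refine Finset.sum_congr rfl fun i _ => ?_
  rw [map_smul, map_smul, smul_eq_mul, smul_eq_mul, mul_comm]

/-- A weakly sequentially complete subspace is norm closed: a norm limit in the ambient space is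
also the weak limit. -/
theorem WeaklySequentiallyComplete.isClosed {V : Submodule 𝕜 E}
    (h : WeaklySequentiallyComplete 𝕜 V) : IsClosed (V : Set E) := by
  refine IsSeqClosed.isClosed fun u z hu hz => ?_
  have hlim (Λ : StrongDual 𝕜 E) : Tendsto (fun n => Λ (u n)) atTop (𝓝 (Λ z)) :=
    (Λ.continuous.tendsto z).comp hz
  obtain ⟨a, ha⟩ := h (fun n => ⟨u n, hu n⟩) fun Λ => by
    obtain ⟨Λ', hΛ', -⟩ := exists_extension_norm_eq V Λ
    exact ⟨Λ' z, (hlim Λ').congr fun n => hΛ' ⟨u n, hu n⟩⟩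
  have hza : z = a := (SeparatingDual.eq_iff_forall_dual_eq (R := 𝕜)).2 fun Λ =>
    tendsto_nhds_unique (hlim Λ) (ha (Λ.comp V.subtypeL))
  exact hza ▸ a.2

theorem WeaklySequentiallyComplete.of_finiteDimensional_quotient {V : Submodule 𝕜 E}
    [FiniteDimensional 𝕜 (E ⧸ V)] (h : WeaklySequentiallyComplete 𝕜 V) :
    WeaklySequentiallyComplete 𝕜 E := by
  obtain ⟨P, hP⟩ := Submodule.ClosedComplemented.of_finiteDimensional_quotient h.isClosed
  have hcompl : IsCompl V P.ker := LinearMap.isCompl_of_proj hP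
  have : FiniteDimensional 𝕜 P.ker :=
    (Submodule.quotientEquivOfIsCompl V _ hcompl).finiteDimensional
  have hker : WeaklySequentiallyComplete 𝕜 P.ker :=
    reflexiveSpace_of_finiteDimensional.weaklySequentiallyComplete
  let Q : E →L[𝕜] P.ker := (ContinuousLinearMap.id 𝕜 E - V.subtypeL.comp P).codRestrict P.ker
    fun x => by simp [hP]
  intro x hx
  obtain ⟨a, ha⟩ := h (fun n => P (x n)) fun Λ => hx (Λ.comp P)
  obtain ⟨b, hb⟩ := hker (fun n => Q (x n)) fun Λ => hx (Λ.comp Q)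
  refine ⟨a + b, fun Λ => ?_⟩
  have := (ha (Λ.comp V.subtypeL)).add (hb (Λ.comp P.ker.subtypeL))
  simpa [Q] using this

end NormedSpaces

section FunctionSpaces

variable {Y : Type*} [TopologicalSpace Y]

/-! ### Functions vanishing at infinity -/

namespace ZeroAtInftyContinuousMap

theorem norm_apply_le (f : C₀(Y, ℂ)) (y : Y) : ‖f y‖ ≤ ‖f‖ :=
  f.toBCF.norm_coe_le_norm y

theorem norm_le_of_forall {f : C₀(Y, ℂ)} {C : ℝ} (hC : 0 ≤ C) (h : ∀ y, ‖f y‖ ≤ C) :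
    ‖f‖ ≤ C :=
  (BoundedContinuousFunction.norm_le (f := f.toBCF) hC).2 h

theorem sum_apply (s : Finset ℕ) (u : ℕ → C₀(Y, ℂ)) (y : Y) :
    (∑ i ∈ s, u i) y = ∑ i ∈ s, u i y := by
  induction s using Finset.cons_induction with
  | empty => simp
  | cons i s hi ih => rw [Finset.sum_cons, Finset.sum_cons, add_apply, ih]

/-- Evaluation at a point, as a continuous linear functional. -/
noncomputable def evalCLM (y : Y) : StrongDual ℂ C₀(Y, ℂ) :=
  LinearMap.mkContinuous
    { toFun := fun f => f y
      map_add' := fun _ _ => rfl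
      map_smul' := fun _ _ => rfl } 1 fun f => by simpa using f.norm_apply_le y

theorem exists_norm_apply_eq {f : C₀(Y, ℂ)} (hf : f ≠ 0) : ∃ y, ‖f y‖ = ‖f‖ := by
  obtain ⟨y₁, hy₁⟩ : ∃ y, f y ≠ 0 := by
    by_contra! h
    exact hf (ext h)
  have hev : ∀ᶠ y in cocompact Y, ‖f y‖ ≤ ‖f y₁‖ := by
    have h := (zero_at_infty f).norm
    rw [norm_zero] at h
    exact h.eventually_le_const (norm_pos_iff.2 hy₁)
  obtain ⟨y, hy⟩ := f.continuous.norm.exists_forall_ge' y₁ hev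
  exact ⟨y, (f.norm_apply_le y).antisymm (norm_le_of_forall (norm_nonneg _) hy)⟩

theorem isCompact_setOf_le_norm (f : C₀(Y, ℂ)) {r : ℝ} (hr : 0 < r) :
    IsCompact {y | r ≤ ‖f y‖} := by
  have h := (zero_at_infty f).norm
  rw [norm_zero] at h
  obtain ⟨K, hK, hKr⟩ := mem_cocompact.1 (h.eventually_lt_const hr)
  refine hK.of_isClosed_subset (isClosed_le continuous_const f.continuous.norm) fun y hy => ?_
  by_contra hyK
  exact not_lt.2 hy (by simpa using hKr hyK)

end ZeroAtInftyContinuousMap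

open ZeroAtInftyContinuousMap (evalCLM norm_le_of_forall exists_norm_apply_eq)

/-! ### Weakly unconditionally Cauchy series of functions -/

/-- If the sums `∑ ‖u i y‖` are bounded uniformly in `y`, then so are the norms of `∑ c i • u i`
for unimodular `c`. For a functional `Λ`, choosing the phases `c i` so that
`c i * Λ (u i) = ‖Λ (u i)‖` shows that `∑ Λ (u i)` converges absolutely. Hence the partial sums of
`u` are weakly Cauchy, and their weak limit is also the pointwise limit. -/
theorem WeaklySequentiallyComplete.exists_tendsto_sum {V : Submodule ℂ C₀(Y, ℂ)}
    (hV : WeaklySequentiallyComplete ℂ V) {u : ℕ → C₀(Y, ℂ)} (hu : ∀ n, u n ∈ V) {C : ℝ}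
    (hC : 0 ≤ C) (huC : ∀ n y, ∑ i ∈ Finset.range n, ‖u i y‖ ≤ C) :
    ∃ a ∈ V, ∀ y, Tendsto (fun n => ∑ i ∈ Finset.range n, u i y) atTop (𝓝 (a y)) := by
  let v : ℕ → V := fun n => ⟨u n, hu n⟩
  obtain ⟨a, ha⟩ := hV (fun n => ∑ i ∈ Finset.range n, v i) fun Λ => by
    choose c hc hcΛ using fun i => RCLike.exists_norm_eq_mul_self (Λ (v i))
    have hsum : Summable fun i => Λ (v i) := by
      refine .of_norm (summable_of_sum_range_le (c := ‖Λ‖ * C) (fun _ => norm_nonneg _)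
        fun n => ?_)
      have hnorm : ‖∑ i ∈ Finset.range n, c i • v i‖ ≤ C := by
        rw [Submodule.coe_norm, Submodule.coe_sum]
        refine norm_le_of_forall hC fun y => ?_
        rw [ZeroAtInftyContinuousMap.sum_apply]
        refine (norm_sum_le _ _).trans (le_trans (Finset.sum_le_sum fun i _ => ?_) (huC n y))
        simp [v, hc]
      calc ∑ i ∈ Finset.range n, ‖Λ (v i)‖
          = ‖Λ (∑ i ∈ Finset.range n, c i • v i)‖ := by
            rw [map_sum]
            simp only [map_smul, smul_eq_mul, ← hcΛ]
            rw [← RCLike.ofReal_sum, RCLike.norm_ofReal, abs_of_nonneg]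
            exact Finset.sum_nonneg fun _ _ => norm_nonneg _
        _ ≤ ‖Λ‖ * C := (Λ.le_opNorm _).trans (by gcongr)
    exact ⟨_, by simpa only [map_sum] using hsum.hasSum.tendsto_sum_nat⟩
  refine ⟨a, a.2, fun y => ?_⟩
  have h := ha ((evalCLM y).comp V.subtypeL)
  simp only [map_sum] at h
  exact h

/-! ### Peak idempotents -/

variable {B : NonUnitalSubalgebra ℂ C₀(Y, ℂ)}

/-- The function `f / (1 + n (1 - f))` belongs to the closed algebra `B`: it is the fixed point of
the contraction `g ↦ (f + n f g) / (n + 1)`. -/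
theorem exists_mem_resolvent (hB : IsClosed (B : Set C₀(Y, ℂ))) {f : C₀(Y, ℂ)} (hf : f ∈ B)
    (hf1 : ‖f‖ ≤ 1) (n : ℕ) : ∃ k ∈ B, ∀ y, (1 + n * (1 - f y)) * k y = f y := by
  let T : C₀(Y, ℂ) → C₀(Y, ℂ) := fun g =>
    ((n : ℂ) + 1)⁻¹ • f + ((n : ℂ) / (n + 1)) • (f * g)
  have hmaps : Set.MapsTo T B B := fun g hg =>
    add_mem (SMulMemClass.smul_mem _ hf) (SMulMemClass.smul_mem _ (mul_mem hf hg))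
  have hlip : ∀ g h, dist (T g) (T h) ≤ ((n : NNReal) / (n + 1) : NNReal) * dist g h := by
    intro g h
    have h1 : T g - T h = ((n : ℂ) / (n + 1)) • (f * (g - h)) := by
      ext y
      simp [T]
      ring
    rw [dist_eq_norm, dist_eq_norm, h1, norm_smul]
    have h2 : ‖(n : ℂ) / (n + 1)‖ = n / (n + 1) := by
      rw [norm_div, RCLike.norm_natCast]
      congr 1
      exact_mod_cast RCLike.norm_natCast (K := ℂ) (n + 1)
    rw [h2]
    push_cast
    gcongr
    calc ‖f * (g - h)‖ ≤ ‖f‖ * ‖g - h‖ := norm_mul_le _ _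
      _ ≤ 1 * ‖g - h‖ := by gcongr
      _ = ‖g - h‖ := one_mul _
  have hcontr : ContractingWith ((n : NNReal) / (n + 1)) (hmaps.restrict T B B) := by
    refine ⟨?_, LipschitzWith.of_dist_le_mul fun g h => hlip g h⟩
    rw [div_lt_one (by positivity)]
    exact lt_add_one _
  obtain ⟨k, hk, hfix, -⟩ := hcontr.exists_fixedPoint' hB.isComplete hmaps
    (zero_mem B) (edist_ne_top _ _)
  refine ⟨k, hk, fun y => ?_⟩
  have h := DFunLike.congr_fun hfix.eq y
  simp only [T, ZeroAtInftyContinuousMap.add_apply, ZeroAtInftyContinuousMap.smul_apply,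
    ZeroAtInftyContinuousMap.mul_apply, smul_eq_mul] at h
  have hn : (n : ℂ) + 1 ≠ 0 := by exact_mod_cast n.succ_ne_zero
  field_simp at h
  linear_combination -h

theorem one_add_mul_norm_le {w : ℂ} (hw : 0 ≤ w.re) (n : ℕ) :
    (1 + n * ‖w‖) ^ 2 ≤ 2 * ‖1 + n * w‖ ^ 2 := by
  have h1 : ‖w‖ ^ 2 = w.re ^ 2 + w.im ^ 2 := by
    rw [Complex.sq_norm, Complex.normSq_apply]; ring
  have h2 : ‖1 + n * w‖ ^ 2 = (1 + n * w.re) ^ 2 + (n * w.im) ^ 2 := by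
    rw [Complex.sq_norm, Complex.normSq_apply]; simp; ring
  have h3 : 0 ≤ n * w.re := by positivity
  have h4 : (n * ‖w‖) ^ 2 = (n * w.re) ^ 2 + (n * w.im) ^ 2 := by
    rw [mul_pow, h1]; ring
  rw [h2]
  nlinarith [sq_nonneg (1 - n * ‖w‖)]

/-- The differences of consecutive functions `z / (1 + n (1 - z))` are dominated by a telescoping
series, uniformly in the closed unit disc. -/
theorem norm_resolvent_sub_le {z k k' : ℂ} (hz : ‖z‖ ≤ 1) (n : ℕ)
    (hk : (1 + n * (1 - z)) * k = z) (hk' : (1 + (n + 1 : ℕ) * (1 - z)) * k' = z) :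
    ‖k' - k‖ ≤ 2 * (1 / (1 + n * ‖1 - z‖) - 1 / (1 + (n + 1 : ℕ) * ‖1 - z‖)) := by
  have hw : 0 ≤ (1 - z).re := by
    have := (Complex.re_le_norm z).trans hz
    simpa using this
  set w := 1 - z
  set t := ‖w‖
  have ht : 0 ≤ t := norm_nonneg _
  set m : ℕ := n + 1 with hm
  have hmn : (m : ℝ) = n + 1 := by simp [hm]
  have hmn' : (m : ℂ) = n + 1 := by simp [hm]
  have hA := one_add_mul_norm_le hw n
  have hA' := one_add_mul_norm_le hw m
  set a := 1 + n * t
  set a' := 1 + m * t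
  have ha : 0 < a := by positivity
  have ha' : 0 < a' := by positivity
  have hprod : a * a' ≤ 2 * (‖1 + n * w‖ * ‖1 + m * w‖) := by
    refine (pow_le_pow_iff_left₀ (by positivity) (by positivity) two_ne_zero).1 ?_
    calc (a * a') ^ 2 = a ^ 2 * a' ^ 2 := by ring
      _ ≤ (2 * ‖1 + n * w‖ ^ 2) * (2 * ‖1 + m * w‖ ^ 2) := by gcongr
      _ = _ := by ring
  have hdiff : (1 + n * w) * (1 + m * w) * (k' - k) = -(z * w) := by
    linear_combination (1 + n * w) * hk' - (1 + m * w) * hk - z * w * hmn'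
  have hnorm : ‖1 + n * w‖ * ‖1 + m * w‖ * ‖k' - k‖ ≤ t := by
    rw [← norm_mul, ← norm_mul, hdiff, norm_neg, norm_mul]
    exact mul_le_of_le_one_left ht hz
  have hrhs : 2 * (1 / a - 1 / a') = 2 * t / (a * a') := by
    have : a' - a = t := by simp only [a, a', hmn]; ring
    field_simp
    linarith
  rw [hrhs, le_div_iff₀ (by positivity)]
  nlinarith [norm_nonneg (k' - k)]

theorem tendsto_resolvent {z : ℂ} {k : ℕ → ℂ} (hk : ∀ n : ℕ, (1 + n * (1 - z)) * k n = z)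
    (hz1 : z ≠ 1) : Tendsto k atTop (𝓝 0) := by
  have hw : 1 - z ≠ 0 := sub_ne_zero.2 hz1.symm
  have h : Tendsto (fun n : ℕ => ‖1 + (n : ℂ) * (1 - z)‖) atTop atTop := by
    have h1 : Tendsto (fun n : ℕ => (n : ℝ) * ‖1 - z‖ - 1) atTop atTop :=
      tendsto_atTop_add_const_right _ _
        (tendsto_natCast_atTop_atTop.atTop_mul_const (norm_pos_iff.2 hw))
    refine tendsto_atTop_mono (fun n => ?_) h1
    have := norm_sub_norm_le ((n : ℂ) * (1 - z)) (-1)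
    rw [norm_mul, RCLike.norm_natCast, norm_neg, norm_one, sub_neg_eq_add, add_comm _ (1 : ℂ)]
      at this
    exact this
  refine squeeze_zero_norm' ?_ (h.const_div_atTop ‖z‖)
  filter_upwards [h.eventually_gt_atTop 0] with n hn
  rw [le_div_iff₀ hn, mul_comm, ← norm_mul, hk]

/-- The functions `f / (1 + n (1 - f))` converge pointwise to the indicator function of `{f = 1}`
and have uniformly bounded variation in `n`, so the indicator function lies in `B`. -/
theorem exists_mem_indicator_of_norm_le_one (hB : IsClosed (B : Set C₀(Y, ℂ)))
    (hwsc : WeaklySequentiallyComplete ℂ B.toSubmodule) {f : C₀(Y, ℂ)} (hf : f ∈ B)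
    (hf1 : ‖f‖ ≤ 1) :
    ∃ q ∈ B, ∀ y, (f y = 1 → q y = 1) ∧ (f y ≠ 1 → q y = 0) := by
  choose k hkB hk using exists_mem_resolvent hB hf hf1
  have hfy (y : Y) : ‖f y‖ ≤ 1 := (f.norm_apply_le y).trans hf1
  have hbound (n : ℕ) (y : Y) : ∑ i ∈ Finset.range n, ‖(k (i + 1) - k i) y‖ ≤ 2 := by
    calc ∑ i ∈ Finset.range n, ‖(k (i + 1) - k i) y‖
        ≤ ∑ i ∈ Finset.range n, 2 * (1 / (1 + i * ‖1 - f y‖) -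
            1 / (1 + (i + 1 : ℕ) * ‖1 - f y‖)) :=
          Finset.sum_le_sum fun i _ => norm_resolvent_sub_le (hfy y) i (hk i y) (hk (i + 1) y)
      _ = 2 * (1 - 1 / (1 + n * ‖1 - f y‖)) := by
          rw [← Finset.mul_sum, Finset.sum_range_sub' fun i : ℕ => 1 / (1 + i * ‖1 - f y‖)]
          simp
      _ ≤ 2 := by
          have : 0 ≤ 1 / (1 + n * ‖1 - f y‖) := by positivity
          linarith
  obtain ⟨a, haB, ha⟩ := hwsc.exists_tendsto_sum (u := fun i => k (i + 1) - k i)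
    (fun i => sub_mem (hkB (i + 1)) (hkB i)) zero_le_two hbound
  have hlim (y : Y) : Tendsto (fun n => k n y) atTop (𝓝 ((a + k 0) y)) := by
    refine ((ha y).add_const (k 0 y)).congr fun n => ?_
    simp only [ZeroAtInftyContinuousMap.sub_apply]
    rw [Finset.sum_range_sub fun i => k i y, sub_add_cancel]
  refine ⟨a + k 0, add_mem haB (hkB 0), fun y => ⟨fun hy => ?_, fun hy => ?_⟩⟩
  · refine tendsto_nhds_unique (hlim y) (tendsto_const_nhds.congr fun n => ?_)
    simpa [hy] using (hk n y).symm
  · exact tendsto_nhds_unique (hlim y) (tendsto_resolvent (fun n => hk n y) hy)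

/-- The value `c` is one of maximal modulus: then `c⁻¹ • f` has norm `1` and takes the value `1`. -/
theorem exists_mem_indicator (hB : IsClosed (B : Set C₀(Y, ℂ)))
    (hwsc : WeaklySequentiallyComplete ℂ B.toSubmodule) {f : C₀(Y, ℂ)} (hf : f ∈ B)
    (hf0 : f ≠ 0) :
    ∃ c : ℂ, c ≠ 0 ∧ ∃ q ∈ B, q ≠ 0 ∧ ∀ y, (f y = c → q y = 1) ∧ (f y ≠ c → q y = 0) := by
  obtain ⟨y₀, hy₀⟩ := exists_norm_apply_eq hf0
  have hc : f y₀ ≠ 0 := norm_ne_zero_iff.1 (hy₀ ▸ norm_ne_zero_iff.2 hf0)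
  obtain ⟨q, hqB, hq⟩ := exists_mem_indicator_of_norm_le_one hB hwsc
    (f := (f y₀)⁻¹ • f) (SMulMemClass.smul_mem _ hf)
    (by rw [norm_smul, norm_inv, hy₀, inv_mul_cancel₀ (norm_ne_zero_iff.2 hf0)])
  have hiff (y : Y) : ((f y₀)⁻¹ • f) y = 1 ↔ f y = f y₀ := by
    rw [ZeroAtInftyContinuousMap.smul_apply, smul_eq_mul, inv_mul_eq_one₀ hc, eq_comm]
  refine ⟨f y₀, hc, q, hqB, fun h => ?_, fun y => ?_⟩
  · have := (hq y₀).1 ((hiff y₀).2 rfl)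
    simp [h] at this
  · rw [Ne, ← hiff]
    exact hq y

/-! ### Orthogonal idempotents and finite dimension -/

/-- The sum of a sequence of nonzero orthogonal idempotents in `B` would again lie in `B`. It is
`1` on the disjoint open supports of the summands, infinitely many of which would cover a compact
set without redundancy. -/
theorem not_exists_orthogonal_idempotents
    (hwsc : WeaklySequentiallyComplete ℂ B.toSubmodule) {q : ℕ → C₀(Y, ℂ)}
    (hqB : ∀ n, q n ∈ B) (hq0 : ∀ n, q n ≠ 0) (hidem : ∀ n y, q n y * q n y = q n y)
    (horth : ∀ m n, m < n → ∀ y, q m y * q n y = 0) : False := by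
  have horth' (m n : ℕ) (hmn : m ≠ n) (y : Y) (hm : q m y ≠ 0) : q n y = 0 := by
    rcases hmn.lt_or_gt with h | h
    · exact (mul_eq_zero.1 (horth m n h y)).resolve_left hm
    · exact (mul_eq_zero.1 (horth n m h y)).resolve_right hm
  have hone (n : ℕ) (y : Y) (hn : q n y ≠ 0) : q n y = 1 :=
    mul_left_cancel₀ hn ((hidem n y).trans (mul_one _).symm)
  obtain ⟨a, -, ha⟩ := hwsc.exists_tendsto_sum hqB zero_le_one fun n y => by
    by_cases h : ∃ m, q m y ≠ 0
    · obtain ⟨m, hm⟩ := h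
      calc ∑ i ∈ Finset.range n, ‖q i y‖
          ≤ ∑ i ∈ Finset.range n, if i = m then (1 : ℝ) else 0 := by
            refine Finset.sum_le_sum fun i _ => ?_
            split_ifs with him
            · rw [him, hone m y hm, norm_one]
            · rw [horth' m i (Ne.symm him) y hm, norm_zero]
        _ ≤ 1 := by
            rw [Finset.sum_ite_eq']
            split_ifs <;> norm_num
    · push Not at h
      simp [h]
  have ha1 (m : ℕ) (y : Y) (hm : q m y ≠ 0) : a y = 1 := by
    refine tendsto_nhds_unique (ha y) (tendsto_const_nhds.congr' ?_)
    filter_upwards [eventually_gt_atTop m] with n hn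
    rw [Finset.sum_eq_single_of_mem m (Finset.mem_range.2 hn) fun i _ him =>
      horth' m i him.symm y hm, hone m y hm]
  obtain ⟨s, hs⟩ := (a.isCompact_setOf_le_norm (r := 1 / 2) (by norm_num)).elim_finite_subcover
    (fun n => {y | q n y ≠ 0}) (fun n => isOpen_ne_fun (q n).continuous continuous_const)
    fun y hy => by
      by_contra h
      simp only [Set.mem_iUnion, Set.mem_ofPred_eq, not_exists, not_not] at h
      have : a y = 0 := tendsto_nhds_unique (ha y) (by simp [h])
      rw [Set.mem_ofPred_eq, this, norm_zero] at hy
      norm_num at hy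
  obtain ⟨n, hn⟩ := Infinite.exists_notMem_finset s
  obtain ⟨y, hy⟩ : ∃ y, q n y ≠ 0 := by
    by_contra! h
    exact hq0 n (ZeroAtInftyContinuousMap.ext h)
  have hmem : y ∈ {y | 1 / 2 ≤ ‖a y‖} := by
    rw [Set.mem_ofPred_eq, ha1 n y hy]
    norm_num
  obtain ⟨m, hms, hm⟩ := Set.mem_iUnion₂.1 (hs hmem)
  exact hm (horth' n m (fun h => hn (h ▸ hms)) y hy)

/-- The elements of `B` on which multiplication by the function `p` acts as the identity. -/
def corner (B : NonUnitalSubalgebra ℂ C₀(Y, ℂ)) (p : Y → ℂ) : Submodule ℂ C₀(Y, ℂ) where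
  carrier := {f | f ∈ B ∧ ∀ y, p y * f y = f y}
  add_mem' hf hg := ⟨add_mem hf.1 hg.1, fun y => by
    rw [ZeroAtInftyContinuousMap.add_apply, mul_add, hf.2, hg.2]⟩
  zero_mem' := ⟨zero_mem B, fun y => by simp⟩
  smul_mem' c f hf := ⟨SMulMemClass.smul_mem c hf.1, fun y => by
    rw [ZeroAtInftyContinuousMap.smul_apply, smul_eq_mul, mul_left_comm, hf.2]⟩

theorem corner_le_sup {p : Y → ℂ} {q : C₀(Y, ℂ)} (hq : q ∈ corner B p)
    (hidem : ∀ y, q y * q y = q y) :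
    corner B p ≤ corner B q ⊔ corner B (p - q) := by
  intro f hf
  have h1 : q * f ∈ corner B q := ⟨mul_mem hq.1 hf.1, fun y => by
    rw [ZeroAtInftyContinuousMap.mul_apply]; linear_combination f y * hidem y⟩
  have h2 : f - q * f ∈ corner B (p - q) := ⟨sub_mem hf.1 (mul_mem hq.1 hf.1), fun y => by
    rw [ZeroAtInftyContinuousMap.sub_apply, ZeroAtInftyContinuousMap.mul_apply, Pi.sub_apply]
    linear_combination hf.2 y - f y * hq.2 y + f y * hidem y⟩
  simpa using Submodule.add_mem_sup h1 h2

/-- An infinite-dimensional corner contains a nonzero idempotent whose removal leaves an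
infinite-dimensional corner. -/
theorem exists_idempotent_mem_corner (hB : IsClosed (B : Set C₀(Y, ℂ)))
    (hwsc : WeaklySequentiallyComplete ℂ B.toSubmodule) {p : Y → ℂ}
    (hp : ¬ FiniteDimensional ℂ (corner B p)) :
    ∃ q ∈ corner B p, q ≠ 0 ∧ (∀ y, q y * q y = q y) ∧
      ¬ FiniteDimensional ℂ (corner B (p - q)) := by
  have hsplit {p : Y → ℂ} {q : C₀(Y, ℂ)} (hq : q ∈ corner B p) (hidem : ∀ y, q y * q y = q y)
      (hp : ¬ FiniteDimensional ℂ (corner B p))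
      (h : FiniteDimensional ℂ (corner B (p - q))) : ¬ FiniteDimensional ℂ (corner B q) :=
    fun _ => hp (Submodule.finiteDimensional_of_le (corner_le_sup hq hidem))
  have hind {f q : C₀(Y, ℂ)} {c : ℂ} (h : ∀ y, (f y = c → q y = 1) ∧ (f y ≠ c → q y = 0)) (y : Y) :
      q y * q y = q y := by
    by_cases hy : f y = c
    · simp [(h y).1 hy]
    · simp [(h y).2 hy]
  have hmem {f q : C₀(Y, ℂ)} {c : ℂ} {p : Y → ℂ} (hf : f ∈ corner B p) (hqB : q ∈ B)
      (hc : c ≠ 0) (h : ∀ y, (f y = c → q y = 1) ∧ (f y ≠ c → q y = 0)) : q ∈ corner B p := by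
    refine ⟨hqB, fun y => ?_⟩
    by_cases hy : f y = c
    · have := hf.2 y
      rw [hy] at this
      rw [(h y).1 hy, mul_one]
      exact mul_right_cancel₀ hc (this.trans (one_mul c).symm)
    · rw [(h y).2 hy, mul_zero]
  obtain ⟨f, hf, hf0⟩ : ∃ f ∈ corner B p, f ≠ 0 := by
    by_contra! h
    have hbot : corner B p = ⊥ := (Submodule.eq_bot_iff _).2 h
    exact hp (hbot ▸ inferInstance)
  obtain ⟨c, hc, q, hqB, hq0, hq⟩ := exists_mem_indicator hB hwsc hf.1 hf0
  have hqp := hmem hf hqB hc hq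
  by_cases hfin : FiniteDimensional ℂ (corner B (p - q))
  swap
  · exact ⟨q, hqp, hq0, hind hq, hfin⟩
  -- Now `corner B q` is infinite-dimensional, so it contains a function that is not a multiple
  -- of `q`, and such a function cuts out a proper part `q'` of `q`.
  have hqinf := hsplit hqp (hind hq) hp hfin
  obtain ⟨g, hg, hgq⟩ : ∃ g ∈ corner B q, g ∉ Submodule.span ℂ {q} := by
    by_contra! h
    exact hqinf (Submodule.finiteDimensional_of_le (S₂ := Submodule.span ℂ {q}) h)
  have hg0 : g ≠ 0 := fun h => hgq (h ▸ zero_mem _)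
  obtain ⟨d, hd, q', hq'B, hq'0, hq'⟩ := exists_mem_indicator hB hwsc hg.1 hg0
  have hq'q := hmem hg hq'B hd hq'
  have hi := hind hq
  have hi' := hind hq'
  have hne : q - q' ≠ 0 := fun h => hgq <| by
    rw [sub_eq_zero] at h
    refine Submodule.mem_span_singleton.2 ⟨d, ZeroAtInftyContinuousMap.ext fun y => ?_⟩
    rw [ZeroAtInftyContinuousMap.smul_apply, smul_eq_mul]
    by_cases hy : g y = d
    · rw [h, (hq' y).1 hy, hy, mul_one]
    · have := hg.2 y
      rw [h, (hq' y).2 hy, zero_mul] at this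
      rw [h, (hq' y).2 hy, mul_zero, this]
  have hq'p : q' ∈ corner B p := ⟨hq'B, fun y => by
    linear_combination q' y * hqp.2 y + (1 - p y) * hq'q.2 y⟩
  -- One of the corners of `q'` and `q - q'` is infinite-dimensional; split off the other idempotent.
  by_cases hfin' : FiniteDimensional ℂ (corner B (q - q'))
  · have hq'inf := hsplit hq'q hi' hqinf hfin'
    have hle : corner B q' ≤ corner B (p - (q - q' : C₀(Y, ℂ))) := fun f hf => ⟨hf.1, fun y => by
      rw [Pi.sub_apply, ZeroAtInftyContinuousMap.sub_apply]
      linear_combination (1 + q y - p y) * hf.2 y - f y * hq'q.2 y + f y * hq'p.2 y⟩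
    refine ⟨q - q', sub_mem hqp hq'p, hne, fun y => ?_, fun _ =>
      hq'inf (Submodule.finiteDimensional_of_le hle)⟩
    rw [ZeroAtInftyContinuousMap.sub_apply]
    linear_combination hi y + hi' y - 2 * hq'q.2 y
  · have hle : corner B (q - q') ≤ corner B (p - q') := fun f hf => ⟨hf.1, fun y => by
      have h := hf.2 y
      rw [Pi.sub_apply] at h ⊢
      linear_combination f y * (hqp.2 y - hq'p.2 y - hq'q.2 y + hi' y) - (p y - q' y - 1) * h⟩
    exact ⟨q', hq'p, hq'0, hi', fun _ => hfin' (Submodule.finiteDimensional_of_le hle)⟩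

/-- A closed subalgebra of `C₀(Y, ℂ)` that is weakly sequentially complete is finite-dimensional:
otherwise nonzero orthogonal idempotents could be split off forever. -/
theorem WeaklySequentiallyComplete.finiteDimensional (hB : IsClosed (B : Set C₀(Y, ℂ)))
    (hwsc : WeaklySequentiallyComplete ℂ B.toSubmodule) :
    FiniteDimensional ℂ B.toSubmodule := by
  by_contra hinf
  choose! q hqp hq0 hidem hqinf using fun (p : Y → ℂ) (hp : ¬ FiniteDimensional ℂ (corner B p)) =>
    exists_idempotent_mem_corner hB hwsc hp
  let p : ℕ → Y → ℂ := fun n => (fun r => r - ⇑(q r))^[n] 1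
  have hpsucc (n : ℕ) : p (n + 1) = p n - ⇑(q (p n)) := Function.iterate_succ_apply' _ _ _
  have hpinf (n : ℕ) : ¬ FiniteDimensional ℂ (corner B (p n)) := by
    induction n with
    | zero =>
      have h1 : corner B (p 0) = B.toSubmodule := by
        ext f
        exact ⟨fun h => h.1, fun h => ⟨h, fun y => one_mul _⟩⟩
      rwa [h1]
    | succ n ih => exact hpsucc n ▸ hqinf _ ih
  have hann (m n : ℕ) (hmn : m < n) (y : Y) : q (p m) y * p n y = 0 := by
    induction n, hmn using Nat.le_induction with
    | base =>
      rw [hpsucc, Pi.sub_apply]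
      linear_combination (hqp _ (hpinf m)).2 y - hidem _ (hpinf m) y
    | succ n _ ih =>
      rw [hpsucc, Pi.sub_apply]
      linear_combination (1 - q (p n) y) * ih + q (p m) y * (hqp _ (hpinf n)).2 y
  refine not_exists_orthogonal_idempotents hwsc (q := fun n => q (p n))
    (fun n => (hqp _ (hpinf n)).1) (fun n => hq0 _ (hpinf n)) (fun n => hidem _ (hpinf n))
    fun m n hmn y => ?_
  linear_combination q (p n) y * hann m n hmn y - q (p m) y * (hqp _ (hpinf n)).2 y

end FunctionSpaces

/-! ### Uniform algebras on compact spaces -/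

section Compact

variable {X : Type*} [TopologicalSpace X] [CompactSpace X]

/-- A subalgebra of `C(X, ℂ)`, for compact `X`, regarded as a subalgebra of `C₀(X, ℂ)`. -/
def Subalgebra.toZeroAtInfty (A : Subalgebra ℂ C(X, ℂ)) : NonUnitalSubalgebra ℂ C₀(X, ℂ) where
  carrier := {f | f.toContinuousMap ∈ A}
  add_mem' hf hg := A.add_mem hf hg
  zero_mem' := A.zero_mem
  mul_mem' hf hg := A.mul_mem hf hg
  smul_mem' c _ hf := A.smul_mem hf c

theorem Subalgebra.isClosed_toZeroAtInfty {A : Subalgebra ℂ C(X, ℂ)}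
    (hA : IsClosed (A : Set C(X, ℂ))) : IsClosed (A.toZeroAtInfty : Set C₀(X, ℂ)) := by
  refine hA.preimage (f := fun f : C₀(X, ℂ) => f.toContinuousMap) (Isometry.continuous ?_)
  exact Isometry.of_dist_eq fun f g => rfl

/-- The isometric identification of a subalgebra of `C(X, ℂ)`, for compact `X`, with its copy in
`C₀(X, ℂ)`. -/
noncomputable def Subalgebra.toZeroAtInftyEquiv (A : Subalgebra ℂ C(X, ℂ)) :
    A ≃ₗᵢ[ℂ] A.toZeroAtInfty.toSubmodule where
  toFun f := ⟨ZeroAtInftyContinuousMap.ContinuousMap.liftZeroAtInfty f.1, f.2⟩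
  invFun f := ⟨f.1.toContinuousMap, f.2⟩
  map_add' _ _ := rfl
  map_smul' _ _ := rfl
  left_inv _ := rfl
  right_inv _ := rfl
  norm_map' _ := rfl

end Compact

theorem tfae_of_weaklySequentiallyComplete_imp {E : Type*} [NormedAddCommGroup E] [NormedSpace ℂ E]
    (h : WeaklySequentiallyComplete ℂ E → FiniteDimensional ℂ E) :
    List.TFAE [WeaklySequentiallyComplete ℂ E, ReflexiveSpace ℂ E, FiniteDimensional ℂ E] := by
  tfae_have 1 → 3 := h
  tfae_have 3 → 2 := fun _ => reflexiveSpace_of_finiteDimensional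
  tfae_have 2 → 1 := fun h => h.weaklySequentiallyComplete
  tfae_finish

theorem mainTheorem2 :
    (∀ (X : Type*) [TopologicalSpace X] [CompactSpace X] [T2Space X]
        (A : Subalgebra ℂ C(X, ℂ)), IsUniformAlgebra A →
      List.TFAE [WeaklySequentiallyComplete ℂ A, ReflexiveSpace ℂ A, FiniteDimensional ℂ A]) ∧
    (∀ (Y : Type*) [TopologicalSpace Y] [LocallyCompactSpace Y] [T2Space Y] [NoncompactSpace Y]
        (B : NonUnitalSubalgebra ℂ C₀(Y, ℂ)), IsNonunitalUniformAlgebra B →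
      List.TFAE [WeaklySequentiallyComplete ℂ B.toSubmodule, ReflexiveSpace ℂ B.toSubmodule,
        FiniteDimensional ℂ B.toSubmodule]) ∧
    (∀ (𝕜 : Type*) [RCLike 𝕜] (E : Type*) [NormedAddCommGroup E] [NormedSpace 𝕜 E]
        [CompleteSpace E] (F : Submodule 𝕜 E), FiniteDimensional 𝕜 (E ⧸ F) →
      ¬ WeaklySequentiallyComplete 𝕜 E → ¬ WeaklySequentiallyComplete 𝕜 F) := by
  refine ⟨fun X _ _ _ A hA => tfae_of_weaklySequentiallyComplete_imp fun h => ?_,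
    fun Y _ _ _ _ B hB => tfae_of_weaklySequentiallyComplete_imp fun h =>
      h.finiteDimensional hB.isClosed,
    fun 𝕜 _ E _ _ _ F _ hE hF => hE hF.of_finiteDimensional_quotient⟩
  have hfin : FiniteDimensional ℂ A.toZeroAtInfty.toSubmodule :=
    (h.of_continuousLinearEquiv A.toZeroAtInftyEquiv.toContinuousLinearEquiv).finiteDimensional
      (Subalgebra.isClosed_toZeroAtInfty hA.isClosed)
  exact Module.Finite.equiv A.toZeroAtInftyEquiv.toLinearEquiv.symm
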